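/- Let $q$ be a prime power, $\mathbb{F}_q$ the finite field with $q$ elements, and $n \ge 1$ an integer. For a random variable $X$ taking values in a finite nonempty set $A$, its $q$-ary min-entropy is $$\mathbf{H}^q_\infty(X) = -\log_q\Big(\max_{w\in A}\mathbf{Pr}[X=w]\Big).$$ Then for every random variable $R$ taking values in $\mathbb{F}_q^n$ there exists an onto $\mathbb{F}_q$-linear map $\phi:\mathbb{F}_q^n\to\mathbb{F}_q^{n-1}$ such that $$\mathbf{H}^q_\infty(\phi(R)) \ge \frac{n-1}{n}\,\mathbf{H}^q_\infty(R) - \log_q\left(2-q^{-1}\right).$$ -/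

import Mathlib

open MeasureTheory

/-- The `q`-ary min-entropy `-log_q (max_w Pr[X = w])` of a random variable `X` on the probability
space `(Ω, P)`. It is used for `X` with values in a finite nonempty type, where the supremum is a
maximum over finitely many real numbers. -/
noncomputable def minEntropy {Ω α : Type*} [MeasurableSpace Ω] (q : ℕ) (P : Measure Ω)
    (X : Ω → α) : ℝ :=
  -Real.logb (q : ℝ) (⨆ w : α, P.real {ω | X ω = w})

/-! A surjection onto dimension `n - 1` is fixed, up to isomorphism, by the direction `b` spanning
its kernel, and its fibres are the lines parallel to `b`. Pick the direction whose heaviest line is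
lightest, of mass `M`. Then every direction has a line of mass at least `M`, and a weighted Kakeya
bound gives `(M / (2 - 1/q)) ^ n ≤ ∑ f ^ n ≤ p ^ (n - 1)`, where `f` is the distribution of `R` and
`p = max f`. Logarithms finish.

The Kakeya bound uses the method of multiplicities. Scale `f` by a large integer and round up to
multiplicities `m`. If `∑ (m x + n) ^ n` were too small, `exists_ne_zero_of_card_lt` would give a
nonzero polynomial of low degree vanishing to order `m x` at each `x`. `eq_zero_of_forall_line`
forbids this: low-order Hasse derivatives vanish on the rich lines, so the top homogeneous part has
high multiplicity in every direction, against Schwartz-Zippel. -/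

theorem Polynomial.coeff_prod_sum_of_natDegree_le {ι R : Type*} [CommSemiring R] (s : Finset ι)
    (f : ι → Polynomial R) (d : ι → ℕ) (h : ∀ j ∈ s, (f j).natDegree ≤ d j) :
    (∏ j ∈ s, f j).coeff (∑ j ∈ s, d j) = ∏ j ∈ s, (f j).coeff (d j) := by
  classical
  induction s using Finset.induction_on with
  | empty => simp
  | insert a s ha ih =>
    have hs : ∀ j ∈ s, (f j).natDegree ≤ d j := fun j hj => h j (Finset.mem_insert_of_mem hj)
    rw [Finset.prod_insert ha, Finset.sum_insert ha, Finset.prod_insert ha,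
      Polynomial.coeff_mul_add_eq_of_natDegree_le (h a (Finset.mem_insert_self a s))
        ((Polynomial.natDegree_prod_le _ _).trans (Finset.sum_le_sum hs)), ih hs]

/-! ### Hasse derivatives as coefficients of translates -/

namespace MvPolynomial

/-- The substitution `P ↦ P(X + c)`. The coefficient of `X ^ i` in `translate c P` is the value at
`c` of the `i`-th Hasse derivative of `P`. -/
noncomputable def translate {σ R S : Type*} [CommRing R] [CommRing S] [Algebra R S] (c : σ → S) :
    MvPolynomial σ R →ₐ[R] MvPolynomial σ S :=
  aeval fun j => X j + C (c j)

section Translate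

variable {σ R S : Type*} [CommRing R] [CommRing S] [Algebra R S]

theorem translate_X (c : σ → S) (j : σ) : translate c (X j : MvPolynomial σ R) = X j + C (c j) :=
  aeval_X _ _

theorem translate_translate (a : σ → R) (c : σ → S) (P : MvPolynomial σ R) :
    translate c (translate a P) = translate (fun j => algebraMap R S (a j) + c j) P := by
  have : (translate (R := R) c).comp (translate (R := R) a)
      = translate (fun j => algebraMap R S (a j) + c j) := by
    ext1 j
    simp only [AlgHom.comp_apply, translate_X, map_add]
    have h : translate c (C (a j) : MvPolynomial σ R) = C (algebraMap R S (a j)) := by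
      rw [← algebraMap_eq, AlgHom.commutes]; rfl
    rw [h]; ring
  exact DFunLike.congr_fun this P

theorem translate_zero (P : MvPolynomial σ R) : translate (0 : σ → R) P = P := by
  have : translate (R := R) (0 : σ → R) = AlgHom.id R _ := by
    ext1 j
    simp [translate_X]
  rw [this]; rfl

/-- Truncated subtraction is harmless: the binomial coefficient vanishes when `i j > e j`. -/
theorem coeff_translate_monomial [Fintype σ] (c : σ → S) (e i : σ →₀ ℕ) (p : R) :
    coeff i (translate c (monomial e p)) =
      algebraMap R S p * ∏ j, (c j ^ (e j - i j) * ((e j).choose (i j) : S)) := by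
  classical
  have h1 : translate c (monomial e p)
      = C (algebraMap R S p) * ∏ j, (X j + C (c j)) ^ e j := by
    rw [translate, aeval_monomial, Finsupp.prod_fintype _ _ (fun _ => pow_zero _)]
    rfl
  have h2 : ∀ j, (X j + C (c j) : MvPolynomial σ S) ^ e j =
      ∑ k ∈ Finset.range (e j + 1), monomial (Finsupp.single j k)
        (c j ^ (e j - k) * ((e j).choose k : S)) := by
    intro j
    rw [add_pow]
    refine Finset.sum_congr rfl fun k _ => ?_
    rw [X_pow_eq_monomial, ← C_pow, ← map_natCast (C : S →+* MvPolynomial σ S), mul_assoc, ← C_mul,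
      mul_comm, C_mul_monomial, mul_one]
  have h3 : ∀ k : σ → ℕ, ∏ j, (monomial (Finsupp.single j (k j))
        (c j ^ (e j - k j) * ((e j).choose (k j) : S)) : MvPolynomial σ S)
      = monomial (Finsupp.equivFunOnFinite.symm k)
        (∏ j, (c j ^ (e j - k j) * ((e j).choose (k j) : S))) := by
    intro k
    rw [← monomial_sum_prod]
    have : ∑ j, Finsupp.single j (k j) = Finsupp.equivFunOnFinite.symm k := by
      ext j
      simp [Finsupp.finsetSum_apply, Finsupp.single_apply]
    rw [this]
  rw [h1, coeff_C_mul]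
  congr 1
  simp_rw [h2]
  rw [Finset.prod_univ_sum]
  simp_rw [h3]
  rw [coeff_sum]
  simp_rw [coeff_monomial]
  by_cases hi : (⇑i : σ → ℕ) ∈ Fintype.piFinset fun j => Finset.range (e j + 1)
  · rw [Finset.sum_eq_single_of_mem _ hi]
    · rw [if_pos]
      ext j; simp
    · intro k _ hk
      rw [if_neg]
      rintro rfl
      exact hk (by ext j; simp)
  · rw [Finset.sum_eq_zero]
    · simp only [Fintype.mem_piFinset, Finset.mem_range, not_forall, not_lt] at hi
      obtain ⟨j, hj⟩ := hi
      rw [Finset.prod_eq_zero (Finset.mem_univ j)]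
      rw [Nat.choose_eq_zero_of_lt (by omega)]; simp
    · intro k hk
      rw [if_neg]
      rintro rfl
      exact hi (by simpa using hk)

theorem coeff_translate_eq_sum [Fintype σ] (c : σ → S) (i : σ →₀ ℕ) (P : MvPolynomial σ R) :
    coeff i (translate c P) = ∑ e ∈ P.support, algebraMap R S (coeff e P) *
      ∏ j, (c j ^ (e j - i j) * ((e j).choose (i j) : S)) := by
  conv_lhs => rw [P.as_sum]
  rw [map_sum, coeff_sum]
  simp_rw [coeff_translate_monomial]

end Translate

/-! ### Restricting Hasse derivatives to a line -/

section Line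

variable {σ F : Type*} [Fintype σ] [Field F]

open Polynomial in
/-- The line `t ↦ a + t b`, as a point over the polynomial ring. -/
noncomputable def linePoint (a b : σ → F) : σ → F[X] :=
  fun j => Polynomial.C (a j) + Polynomial.X * Polynomial.C (b j)

-- Re-expand around `a + t b`: the displacement is `(X - t) b`, and only monomials of degree at
-- least `m` survive there.
open Polynomial in
theorem pow_dvd_coeff_translate_linePoint (P : MvPolynomial σ F) (a b : σ → F) (t : F) (m : ℕ)
    (h : ∀ r : σ →₀ ℕ, r.degree < m → coeff r (translate (a + t • b) P) = 0) (i : σ →₀ ℕ) :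
    (Polynomial.X - Polynomial.C t) ^ (m - i.degree) ∣ coeff i (translate (linePoint a b) P) := by
  have h1 : translate (linePoint a b) P =
      translate (fun j => (Polynomial.X - Polynomial.C t) * Polynomial.C (b j))
        (translate (a + t • b) P) := by
    rw [translate_translate]
    congr 2
    ext1 j
    simp only [linePoint, Pi.add_apply, Pi.smul_apply, smul_eq_mul, Polynomial.algebraMap_eq,
      map_add, map_mul]
    ring
  rw [h1, coeff_translate_eq_sum]
  refine Finset.dvd_sum fun r hr => Dvd.dvd.mul_left ?_ _
  have hm : m ≤ r.degree := by
    by_contra hlt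
    exact mem_support_iff.1 hr (h r (not_le.1 hlt))
  by_cases hir : i ≤ r
  · have hd : m - i.degree ≤ ∑ j, (r j - i j) := by
      rw [Finset.sum_tsub_distrib _ (fun j _ => hir j), ← Finsupp.degree_eq_sum,
        ← Finsupp.degree_eq_sum]
      omega
    refine (pow_dvd_pow _ hd).trans ?_
    rw [← Finset.prod_pow_eq_pow_sum]
    refine Finset.prod_dvd_prod_of_dvd _ _ fun j _ => ?_
    rw [mul_pow, mul_assoc]
    exact dvd_mul_right _ _
  · obtain ⟨j, hj⟩ : ∃ j, r j < i j := by
      simpa [Finsupp.le_def] using hir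
    rw [Finset.prod_eq_zero (Finset.mem_univ j)]
    · exact dvd_zero _
    · rw [Nat.choose_eq_zero_of_lt hj]; simp

theorem natDegree_coeff_translate_linePoint_le (P : MvPolynomial σ F) (a b : σ → F) (i : σ →₀ ℕ) :
    (coeff i (translate (linePoint a b) P)).natDegree ≤ P.totalDegree - i.degree := by
  rw [coeff_translate_eq_sum]
  refine Polynomial.natDegree_sum_le_of_forall_le _ _ fun r hr => ?_
  rw [Polynomial.algebraMap_eq]
  refine (Polynomial.natDegree_C_mul_le _ _).trans ?_
  by_cases hir : i ≤ r
  · have hd : ∑ j, (r j - i j) ≤ P.totalDegree - i.degree := by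
      rw [Finset.sum_tsub_distrib _ (fun j _ => hir j), ← Finsupp.degree_eq_sum,
        ← Finsupp.degree_eq_sum]
      have : r.degree ≤ P.totalDegree := le_totalDegree hr
      omega
    refine (Polynomial.natDegree_prod_le _ _).trans ((Finset.sum_le_sum fun j _ => ?_).trans hd)
    rw [linePoint]
    compute_degree
  · obtain ⟨j, hj⟩ : ∃ j, r j < i j := by
      simpa [Finsupp.le_def] using hir
    rw [Finset.prod_eq_zero (Finset.mem_univ j)]
    · simp
    · rw [Nat.choose_eq_zero_of_lt hj]; simp

/-- Only monomials of top degree reach this power of the line parameter, and in them each factor `a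
j + X b j` contributes `b j`. -/
theorem coeff_coeff_translate_linePoint (P : MvPolynomial σ F) (a b : σ → F) (i : σ →₀ ℕ)
    (hi : i.degree ≤ P.totalDegree) :
    (coeff i (translate (linePoint a b) P)).coeff (P.totalDegree - i.degree) =
      coeff i (translate b (homogeneousComponent P.totalDegree P)) := by
  classical
  rw [homogeneousComponent_apply, map_sum, coeff_sum, coeff_translate_eq_sum,
    Polynomial.finsetSum_coeff, Finset.sum_filter]
  refine Finset.sum_congr rfl fun r hr => ?_
  rw [coeff_translate_monomial, Polynomial.algebraMap_eq, Polynomial.coeff_C_mul,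
    Algebra.algebraMap_self, RingHom.id_apply]
  by_cases hir : i ≤ r
  · have hs : ∑ j, (r j - i j) = r.degree - i.degree := by
      rw [Finset.sum_tsub_distrib _ (fun j _ => hir j), ← Finsupp.degree_eq_sum,
        ← Finsupp.degree_eq_sum]
    have hle : r.degree ≤ P.totalDegree := le_totalDegree hr
    have hid : i.degree ≤ r.degree := Finsupp.degree_mono hir
    have hnat : ∀ j, (linePoint a b j ^ (r j - i j) *
        ((r j).choose (i j) : Polynomial F)).natDegree ≤ r j - i j := by
      intro j
      rw [linePoint]
      compute_degree
    split_ifs with hrd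
    · congr 1
      rw [← hrd, ← hs, Polynomial.coeff_prod_sum_of_natDegree_le _ _ _ fun j _ => hnat j]
      refine Finset.prod_congr rfl fun j _ => ?_
      rw [← Polynomial.C_eq_natCast, Polynomial.coeff_mul_C, linePoint]
      have h1 : (Polynomial.C (a j) + Polynomial.X * Polynomial.C (b j)).natDegree ≤ 1 := by
        compute_degree
      have h2 := Polynomial.coeff_pow_of_natDegree_le (m := r j - i j) h1
      rw [mul_one] at h2
      rw [h2]
      simp
    · rw [Polynomial.coeff_eq_zero_of_natDegree_lt, mul_zero]
      refine ((Polynomial.natDegree_prod_le _ _).trans (Finset.sum_le_sum fun j _ =>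
        hnat j)).trans_lt ?_
      omega
  · obtain ⟨j, hj⟩ : ∃ j, r j < i j := by
      simpa [Finsupp.le_def] using hir
    rw [Finset.prod_eq_zero (Finset.mem_univ j), Finset.prod_eq_zero (Finset.mem_univ j)]
    · simp
    · rw [Nat.choose_eq_zero_of_lt hj]; simp
    · rw [Nat.choose_eq_zero_of_lt hj]; simp

end Line

end MvPolynomial

theorem Polynomial.sum_le_natDegree_of_pow_dvd {F : Type*} [Field F] [Fintype F]
    {g : Polynomial F} (hg : g ≠ 0) (k : F → ℕ)
    (h : ∀ t, (Polynomial.X - Polynomial.C t) ^ k t ∣ g) : ∑ t, k t ≤ g.natDegree := by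
  have hdvd : ∏ t, (Polynomial.X - Polynomial.C t) ^ k t ∣ g :=
    Fintype.prod_dvd_of_coprime
      (fun _ _ hst => (Polynomial.pairwise_coprime_X_sub_C Function.injective_id hst).pow) h
  have := Polynomial.natDegree_le_of_dvd hdvd hg
  rwa [Polynomial.natDegree_prod _ _ fun t _ => pow_ne_zero _ (Polynomial.X_sub_C_ne_zero t),
    Finset.sum_congr rfl fun t _ => by
      rw [Polynomial.natDegree_pow, Polynomial.natDegree_X_sub_C, mul_one]] at this

/-! ### Schwartz-Zippel and vanishing along lines -/

namespace MvPolynomial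

variable {F : Type*} [Field F]

theorem coeff_finSuccEquiv_monomial {n : ℕ} (e : Fin (n + 1) →₀ ℕ) (p : F) (k : ℕ) :
    (finSuccEquiv F n (monomial e p)).coeff k = if e 0 = k then monomial e.tail p else 0 := by
  classical
  ext m
  rw [finSuccEquiv_coeff_coeff, coeff_monomial]
  by_cases hk : e 0 = k
  · rw [if_pos hk, coeff_monomial]
    have : e = m.cons k ↔ e.tail = m := by
      constructor
      · rintro rfl; exact Finsupp.tail_cons _ _
      · rintro rfl; rw [← hk, Finsupp.cons_tail]
    simp only [this]
  · rw [if_neg hk, if_neg, coeff_zero]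
    rintro rfl
    exact hk (Finsupp.cons_zero _ _)

/-- On a line parallel to the first axis, differentiating in the other variables commutes with
taking coefficients in the first. -/
theorem coeff_coeff_translate_linePoint_cons {n : ℕ} (P : MvPolynomial (Fin (n + 1)) F)
    (a : Fin n → F) (i : Fin n →₀ ℕ) (k : ℕ) :
    (coeff (i.cons 0) (translate (linePoint (Fin.cons 0 a) (Fin.cons 1 0)) P)).coeff k =
      coeff i (translate a ((finSuccEquiv F n P).coeff k)) := by
  induction P using MvPolynomial.induction_on' with
  | add p q hp hq => simp only [map_add, coeff_add, Polynomial.coeff_add, hp, hq]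
  | monomial e p =>
    rw [coeff_translate_monomial, coeff_finSuccEquiv_monomial, Fin.prod_univ_succ]
    have h : ∀ j : Fin n, linePoint (Fin.cons 0 a : Fin (n + 1) → F) (Fin.cons 1 0) j.succ ^
          (e j.succ - i.cons 0 j.succ) * ((e j.succ).choose (i.cons 0 j.succ) : Polynomial F)
        = Polynomial.C (a j ^ (e.tail j - i j) * ((e.tail j).choose (i j) : F)) := by
      intro j
      simp [linePoint, Finsupp.tail_apply]
    rw [Finset.prod_congr rfl fun j _ => h j, ← map_prod]
    have h0 : linePoint (Fin.cons 0 a : Fin (n + 1) → F) (Fin.cons 1 0) 0 = Polynomial.X := by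
      simp [linePoint]
    rw [h0, Finsupp.cons_zero, Nat.sub_zero, Nat.choose_zero_right, Nat.cast_one, mul_one,
      Polynomial.algebraMap_eq, Polynomial.coeff_C_mul, Polynomial.coeff_mul_C,
      Polynomial.coeff_X_pow]
    by_cases hk : e 0 = k
    · rw [if_pos hk, if_pos hk.symm, coeff_translate_monomial, one_mul]
      rfl
    · rw [if_neg hk, if_neg (Ne.symm hk)]
      simp

/-- A form of the Schwartz-Zippel lemma with multiplicities: over a field with `q` elements, a
nonzero polynomial of degree `d` has multiplicity at most `d / q` at some point. -/
theorem exists_coeff_translate_ne_zero [Fintype F] {n : ℕ} {P : MvPolynomial (Fin n) F}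
    (hP : P ≠ 0) : ∃ (a : Fin n → F) (i : Fin n →₀ ℕ),
      Fintype.card F * i.degree ≤ P.totalDegree ∧ coeff i (translate a P) ≠ 0 := by
  induction n with
  | zero =>
    obtain ⟨i, hi⟩ := exists_coeff_ne_zero hP
    refine ⟨0, i, ?_, by rwa [translate_zero]⟩
    simp [Subsingleton.elim i 0]
  | succ n ih =>
    set p := finSuccEquiv F n P with hp
    have hp0 : p ≠ 0 := by simpa [hp] using hP
    have hlead : p.coeff p.natDegree ≠ 0 := by simpa using hp0
    obtain ⟨a, i, hdeg, hai⟩ := ih hlead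
    have htot : (p.coeff p.natDegree).totalDegree + p.natDegree ≤ P.totalDegree :=
      totalDegree_coeff_finSuccEquiv_add_le P p.natDegree hlead
    by_contra! hcon
    set q := Fintype.card F with hq
    have hq0 : 0 < q := Fintype.card_pos
    set g := coeff (i.cons 0) (translate (linePoint (Fin.cons 0 a) (Fin.cons 1 0)) P) with hg
    have hgc : ∀ k, g.coeff k = coeff i (translate a (p.coeff k)) :=
      coeff_coeff_translate_linePoint_cons P a i
    have hg0 : g ≠ 0 := by
      intro h
      apply hai
      rw [← hgc, h, Polynomial.coeff_zero]
    have hgdeg : g.natDegree ≤ p.natDegree := by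
      refine Polynomial.natDegree_le_iff_coeff_eq_zero.2 fun k hk => ?_
      rw [hgc, Polynomial.coeff_eq_zero_of_natDegree_lt hk, map_zero, coeff_zero]
    -- Were every multiplicity above `d / q`, `g` would have too many zeros on this line for its
    -- degree.
    have hdvd : ∀ t : F, (Polynomial.X - Polynomial.C t) ^
        (P.totalDegree / q + 1 - (i.cons 0).degree) ∣ g := by
      intro t
      refine pow_dvd_coeff_translate_linePoint P _ _ t _ (fun r hr => hcon _ _ ?_) _
      calc q * r.degree ≤ q * (P.totalDegree / q) := Nat.mul_le_mul_left _ (by omega)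
        _ ≤ P.totalDegree := Nat.mul_div_le _ _
    have hsum := Polynomial.sum_le_natDegree_of_pow_dvd hg0 _ hdvd
    have hid : (i.cons 0).degree = i.degree := by
      rw [Finsupp.degree_eq_sum, Finsupp.degree_eq_sum, Fin.sum_univ_succ]
      simp
    rw [Finset.sum_const, Finset.card_univ, smul_eq_mul, hid, Nat.mul_sub, ← hq] at hsum
    have hlt : P.totalDegree < q * (P.totalDegree / q + 1) := Nat.lt_mul_div_succ _ hq0
    omega

/-- If `P` has high multiplicity along a line in every direction, then `P = 0`. -/
theorem eq_zero_of_forall_line [Fintype F] {n l : ℕ} (hn : 1 ≤ n) (m : (Fin n → F) → ℕ)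
    (hm : ∀ b : Fin n → F, b ≠ 0 → ∃ a : Fin n → F,
      l * (2 * Fintype.card F - 1) ≤ ∑ t : F, m (a + t • b))
    {P : MvPolynomial (Fin n) F} (hdeg : P.totalDegree < l * Fintype.card F)
    (hP : ∀ x, ∀ r : Fin n →₀ ℕ, r.degree < m x → coeff r (translate x P) = 0) : P = 0 := by
  by_contra hP0
  set q := Fintype.card F with hq
  have hq1 : 1 < q := Fintype.one_lt_card
  set H := homogeneousComponent P.totalDegree P with hH
  have key : ∀ b : Fin n → F, b ≠ 0 → ∀ i : Fin n →₀ ℕ, q * i.degree ≤ P.totalDegree →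
      coeff i (translate b H) = 0 := by
    intro b hb i hi
    have hid : i.degree ≤ P.totalDegree := (Nat.le_mul_of_pos_left _ (by omega)).trans hi
    obtain ⟨a, ha⟩ := hm b hb
    rw [hH, ← coeff_coeff_translate_linePoint P a b i hid]
    set g := coeff i (translate (linePoint a b) P) with hg
    suffices h : g = 0 by rw [h, Polynomial.coeff_zero]
    by_contra hg0
    have hsum := Polynomial.sum_le_natDegree_of_pow_dvd hg0 (fun t => m (a + t • b) - i.degree)
      fun t => pow_dvd_coeff_translate_linePoint P a b t _ (hP _) i
    have hle : ∑ t : F, m (a + t • b) ≤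
        ∑ t : F, (m (a + t • b) - i.degree) + q * i.degree := by
      rw [hq, ← smul_eq_mul, ← Finset.card_univ, ← Finset.sum_const, ← Finset.sum_add_distrib]
      exact Finset.sum_le_sum fun t _ => by omega
    have hgd : g.natDegree ≤ P.totalDegree - i.degree :=
      natDegree_coeff_translate_linePoint_le P a b i
    have hil : i.degree < l := by
      by_contra! h
      have := Nat.mul_le_mul_left q h
      rw [mul_comm q l] at this
      omega
    -- For `|i| < l` the zeros number at least `l(2q-1) - q|i|`, more than the degree bound, which
    -- is below `lq - |i|`.
    obtain ⟨s, hs⟩ : ∃ s, q = s + 1 := ⟨q - 1, by omega⟩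
    have h2 : 2 * (s + 1) - 1 = 2 * s + 1 := by omega
    rw [hs, h2] at ha
    rw [hs] at hle hdeg
    have h3 := Nat.mul_le_mul_left s hil.le
    have h4 : ∑ t : F, (m (a + t • b) - i.degree) + i.degree ≤ P.totalDegree := by omega
    nlinarith
  have hH0 : H ≠ 0 := by
    intro h
    have hne : P.support.Nonempty := by
      rwa [Finset.nonempty_iff_ne_empty, ne_eq, support_eq_empty]
    obtain ⟨e, he, hed⟩ := Finset.exists_mem_eq_sup P.support hne fun s => s.sum fun _ e => e
    have : coeff e H = coeff e P := by
      rw [hH, coeff_homogeneousComponent, if_pos]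
      exact hed.symm
    rw [h, coeff_zero] at this
    exact mem_support_iff.1 he this.symm
  have hHd : H.IsHomogeneous P.totalDegree := homogeneousComponent_isHomogeneous _ _
  obtain ⟨b, i, hi, hbi⟩ := exists_coeff_translate_ne_zero hH0
  rw [hHd.totalDegree hH0, ← hq] at hi
  -- At the origin the multiplicity of `H` is its full degree, so `b = 0` is possible only for
  -- constant `H`.
  by_cases hb : b = 0
  · subst hb
    rw [translate_zero] at hbi
    have hid : i.degree = P.totalDegree := by
      by_contra hne
      exact hbi (hHd.coeff_eq_zero hne)
    have hd0 : P.totalDegree = 0 := by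
      rw [hid] at hi
      by_contra hne
      have := Nat.mul_lt_mul_of_pos_right hq1 (Nat.pos_of_ne_zero hne)
      omega
    have hi0 : i = 0 := by rwa [hd0, Finsupp.degree_eq_zero_iff] at hid
    obtain ⟨c, hc⟩ : ∃ c, H = C c :=
      ⟨_, totalDegree_eq_zero_iff_eq_C.1 (by rw [hHd.totalDegree hH0, hd0])⟩
    have hb1 : (fun _ => 1 : Fin n → F) ≠ 0 := fun h =>
      one_ne_zero (congrFun h ⟨0, hn⟩)
    have := key _ hb1 0 (by simp)
    rw [hc, translate, aeval_C, algebraMap_eq, coeff_C, if_pos rfl] at this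
    rw [hc, hi0, coeff_C, if_pos rfl] at hbi
    exact hbi this
  · exact hbi (key b hb i hi)

end MvPolynomial

/-! ### Counting monomials and interpolation -/

/-- The exponents of the monomials of degree less than `m` in `n` variables. -/
noncomputable def exponentsOfDegreeLT (n m : ℕ) : Finset (Fin n →₀ ℕ) :=
  (Finsupp.finite_of_degree_lt (σ := Fin n) m).toFinset

theorem mem_exponentsOfDegreeLT {n m : ℕ} {i : Fin n →₀ ℕ} :
    i ∈ exponentsOfDegreeLT n m ↔ i.degree < m := by
  simp [exponentsOfDegreeLT]

theorem card_exponentsOfDegreeLT {n : ℕ} (hn : 1 ≤ n) (m : ℕ) :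
    (exponentsOfDegreeLT n m).card = (m + n - 1).choose n := by
  classical
  have h : exponentsOfDegreeLT n m =
      (Finset.range m).biUnion fun k => Finset.univ.finsuppAntidiag k := by
    ext i
    simp [mem_exponentsOfDegreeLT, Finsupp.degree_eq_sum]
  rw [h, Finset.card_biUnion]
  · simp_rw [Finset.card_finsuppAntidiag_nat_eq_choose, Finset.card_univ, Fintype.card_fin]
    obtain ⟨k, rfl⟩ : ∃ k, n = k + 1 := ⟨n - 1, by omega⟩
    cases m with
    | zero => simp
    | succ m =>
      rw [show m + 1 + (k + 1) - 1 = m + k + 1 by omega, ← Nat.sum_range_add_choose]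
      refine Finset.sum_congr rfl fun i _ => ?_
      rw [show k + 1 + i - 1 = i + k by omega, Nat.choose_symm_add]
  · intro i _ j _ hij
    rw [Function.onFun, Finset.disjoint_left]
    intro e hi hj
    rw [Finset.mem_finsuppAntidiag] at hi hj
    exact hij (hi.1.symm.trans hj.1)

theorem pow_le_factorial_mul_card_exponentsOfDegreeLT {n : ℕ} (hn : 1 ≤ n) (m : ℕ) :
    m ^ n ≤ n.factorial * (exponentsOfDegreeLT n m).card := by
  rw [card_exponentsOfDegreeLT hn, ← Nat.ascFactorial_eq_factorial_mul_choose']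
  exact Nat.pow_succ_le_ascFactorial m n

theorem factorial_mul_card_exponentsOfDegreeLT_le {n : ℕ} (hn : 1 ≤ n) (m : ℕ) :
    n.factorial * (exponentsOfDegreeLT n m).card ≤ (m + n) ^ n := by
  rw [card_exponentsOfDegreeLT hn, ← Nat.descFactorial_eq_factorial_mul_choose]
  exact (Nat.descFactorial_le_pow _ _).trans (Nat.pow_le_pow_left (by omega) n)

namespace MvPolynomial

variable {F : Type*} [Field F] [Fintype F]

/-- There are more unknown coefficients than linear vanishing conditions. -/
theorem exists_ne_zero_of_card_lt {n D : ℕ} (m : (Fin n → F) → ℕ)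
    (h : ∑ x, (exponentsOfDegreeLT n (m x)).card < (exponentsOfDegreeLT n D).card) :
    ∃ P : MvPolynomial (Fin n) F, P ≠ 0 ∧ P.totalDegree < D ∧
      ∀ x, ∀ r : Fin n →₀ ℕ, r.degree < m x → coeff r (translate x P) = 0 := by
  classical
  let poly : (exponentsOfDegreeLT n D → F) →ₗ[F] MvPolynomial (Fin n) F :=
    ∑ e, (monomial e.1).comp (LinearMap.proj e)
  let f : (exponentsOfDegreeLT n D → F) →ₗ[F]
      ((Σ x : Fin n → F, exponentsOfDegreeLT n (m x)) → F) :=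
    LinearMap.pi fun s => (lcoeff F s.2.1).comp ((translate s.1).toLinearMap.comp poly)
  have hker : LinearMap.ker f ≠ ⊥ := by
    apply LinearMap.ker_ne_bot_of_finrank_lt
    simpa using h
  obtain ⟨v, hv, hv0⟩ := Submodule.exists_mem_ne_zero_of_ne_bot hker
  have hpoly : poly v = ∑ e, monomial e.1 (v e) := by
    simp [poly]
  obtain ⟨e, he⟩ := Function.ne_iff.1 hv0
  have hcoeff : coeff e.1 (poly v) = v e := by
    rw [hpoly, coeff_sum, Finset.sum_eq_single_of_mem e (Finset.mem_univ e), coeff_monomial,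
      if_pos rfl]
    intro e' _ hne
    rw [coeff_monomial, if_neg fun h => hne (Subtype.ext h)]
  have hD : 0 < D := (Nat.zero_le _).trans_lt (mem_exponentsOfDegreeLT.1 e.2)
  refine ⟨poly v, ?_, ?_, ?_⟩
  · intro h0
    rw [h0, coeff_zero] at hcoeff
    exact he hcoeff.symm
  · rw [hpoly, Nat.lt_iff_le_pred hD]
    refine totalDegree_finsetSum_le fun e _ => (totalDegree_monomial_le _ _).trans ?_
    exact Nat.le_pred_of_lt (mem_exponentsOfDegreeLT.1 e.2)
  · intro x r hr
    exact congrFun (LinearMap.mem_ker.1 hv) ⟨x, r, mem_exponentsOfDegreeLT.2 hr⟩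

end MvPolynomial

/-! ### The weighted Kakeya bound -/

section Kakeya

variable {F : Type*} [Field F] [Fintype F]

theorem pow_le_sum_pow_of_forall_line {n l : ℕ} (hn : 1 ≤ n) (m : (Fin n → F) → ℕ)
    (hm : ∀ b : Fin n → F, b ≠ 0 → ∃ a : Fin n → F,
      l * (2 * Fintype.card F - 1) ≤ ∑ t : F, m (a + t • b)) :
    (l * Fintype.card F) ^ n ≤ ∑ x, (m x + n) ^ n := by
  have h : (exponentsOfDegreeLT n (l * Fintype.card F)).card ≤
      ∑ x, (exponentsOfDegreeLT n (m x)).card := by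
    by_contra! hlt
    obtain ⟨P, hP0, hdeg, hP⟩ := MvPolynomial.exists_ne_zero_of_card_lt m hlt
    exact hP0 (MvPolynomial.eq_zero_of_forall_line hn m hm hdeg hP)
  calc (l * Fintype.card F) ^ n
      ≤ n.factorial * (exponentsOfDegreeLT n (l * Fintype.card F)).card :=
        pow_le_factorial_mul_card_exponentsOfDegreeLT hn _
    _ ≤ ∑ x, n.factorial * (exponentsOfDegreeLT n (m x)).card := by
        rw [← Finset.mul_sum]
        exact Nat.mul_le_mul_left _ h
    _ ≤ ∑ x, (m x + n) ^ n :=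
        Finset.sum_le_sum fun x _ => factorial_mul_card_exponentsOfDegreeLT_le hn _

/-- A weighted Kakeya bound: a nonnegative function having mass at least `M` on some line in
every direction has large `ℓⁿ` norm. -/
theorem div_pow_le_sum_pow_of_forall_line {n : ℕ} (hn : 1 ≤ n) (f : (Fin n → F) → ℝ)
    (hf : ∀ x, 0 ≤ f x) {M : ℝ} (hM : 0 < M)
    (h : ∀ b : Fin n → F, b ≠ 0 → ∃ a : Fin n → F, M ≤ ∑ t : F, f (a + t • b)) :
    (M / (2 - (Fintype.card F : ℝ)⁻¹)) ^ n ≤ ∑ x, f x ^ n := by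
  set q := Fintype.card F with hq
  have hq1 : (1 : ℝ) < q := by exact_mod_cast Fintype.one_lt_card (α := F)
  have hc : (0 : ℝ) < 2 * q - 1 := by linarith
  -- In the error `n + 1`, `n` comes from the monomial count and `1` from the ceiling; it vanishes
  -- as `l → ∞`. The scale is `l + 1` to avoid dividing by zero.
  have key : ∀ l : ℕ, (q : ℝ) ^ n ≤
      ∑ x, ((2 * q - 1) / M * f x + (n + 1 : ℝ) * ((l : ℝ) + 1)⁻¹) ^ n := by
    intro l
    have hl : (0 : ℝ) < (l : ℝ) + 1 := by positivity
    have hcount := pow_le_sum_pow_of_forall_line (l := l + 1) hn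
      (fun x => ⌈((l : ℝ) + 1) * (2 * q - 1) / M * f x⌉₊) fun b hb => by
        obtain ⟨a, ha⟩ := h b hb
        refine ⟨a, ?_⟩
        have h1 : ((l : ℝ) + 1) * (2 * q - 1) ≤
            ∑ t : F, ((l : ℝ) + 1) * (2 * q - 1) / M * f (a + t • b) := by
          rw [← Finset.mul_sum, div_mul_eq_mul_div, le_div_iff₀ hM]
          exact mul_le_mul_of_nonneg_left ha (by positivity)
        have h2 : ((l : ℝ) + 1) * (2 * q - 1) ≤
            ∑ t : F, (⌈((l : ℝ) + 1) * (2 * q - 1) / M * f (a + t • b)⌉₊ : ℝ) :=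
          h1.trans (Finset.sum_le_sum fun t _ => Nat.le_ceil _)
        have h3 : 1 ≤ 2 * q := by have := Fintype.card_pos (α := F); omega
        rw [← hq]
        have h4 : (((l + 1) * (2 * q - 1) : ℕ) : ℝ) = ((l : ℝ) + 1) * (2 * q - 1) := by
          push_cast [h3]; ring
        rw [← h4] at h2
        exact_mod_cast h2
    have hreal : (((l : ℝ) + 1) * q) ^ n ≤
        ∑ x, ((⌈((l : ℝ) + 1) * (2 * q - 1) / M * f x⌉₊ : ℝ) + n) ^ n := by
      exact_mod_cast hcount
    have hbound : (((l : ℝ) + 1) * q) ^ n ≤ ∑ x, (((l : ℝ) + 1) *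
        ((2 * q - 1) / M * f x + (n + 1 : ℝ) * ((l : ℝ) + 1)⁻¹)) ^ n := by
      refine hreal.trans (Finset.sum_le_sum fun x _ => pow_le_pow_left₀ (by positivity) ?_ n)
      have h5 : (0 : ℝ) ≤ ((l : ℝ) + 1) * (2 * q - 1) / M * f x :=
        mul_nonneg (by positivity) (hf x)
      have h6 := Nat.ceil_lt_add_one h5
      have h7 : ((l : ℝ) + 1) * ((2 * q - 1) / M * f x + (n + 1 : ℝ) * ((l : ℝ) + 1)⁻¹)
          = ((l : ℝ) + 1) * (2 * q - 1) / M * f x + (n + 1) := by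
        field_simp
      rw [h7]
      linarith
    simp_rw [mul_pow ((l : ℝ) + 1)] at hbound
    rw [← Finset.mul_sum] at hbound
    exact le_of_mul_le_mul_left hbound (by positivity)
  have hlim : Filter.Tendsto (fun l : ℕ =>
      ∑ x, ((2 * q - 1) / M * f x + (n + 1 : ℝ) * ((l : ℝ) + 1)⁻¹) ^ n) Filter.atTop
      (nhds (∑ x, ((2 * q - 1) / M * f x + (n + 1 : ℝ) * 0) ^ n)) := by
    refine tendsto_finsetSum _ fun x _ => ((Filter.Tendsto.const_mul _ ?_).const_add _).pow n
    simpa using tendsto_one_div_add_atTop_nhds_zero_nat (𝕜 := ℝ)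
  have hfin := ge_of_tendsto' hlim key
  simp_rw [mul_zero, add_zero, mul_pow] at hfin
  rw [← Finset.mul_sum] at hfin
  have heq : M / (2 - (q : ℝ)⁻¹) = q / ((2 * q - 1) / M) := by
    have : (2 : ℝ) - (q : ℝ)⁻¹ = (2 * q - 1) / q := by field_simp
    rw [this]
    field_simp
  rw [heq, div_pow, div_le_iff₀ (by positivity), mul_comm]
  exact hfin

end Kakeya

/-! ### From lines to linear maps and entropy -/

theorem exists_surjective_ker_eq_span {F : Type*} [Field F] {n : ℕ} {b : Fin n → F} (hb : b ≠ 0) :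
    ∃ φ : (Fin n → F) →ₗ[F] (Fin (n - 1) → F),
      Function.Surjective φ ∧ LinearMap.ker φ = F ∙ b := by
  have h : Module.finrank F ((Fin n → F) ⧸ (F ∙ b)) = Module.finrank F (Fin (n - 1) → F) := by
    have := Submodule.finrank_quotient_add_finrank (F ∙ b)
    rw [finrank_span_singleton hb, Module.finrank_fin_fun] at this
    rw [Module.finrank_fin_fun]
    omega
  let e := LinearEquiv.ofFinrankEq _ _ h
  refine ⟨e.toLinearMap.comp (F ∙ b).mkQ, ?_, ?_⟩
  · exact e.surjective.comp (Submodule.mkQ_surjective _)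
  · rw [LinearEquiv.ker_comp, Submodule.ker_mkQ]

theorem sum_measureReal_eq {F Ω : Type*} [MeasurableSpace F] [MeasurableSingletonClass F]
    [MeasurableSpace Ω] (P : Measure Ω) [IsProbabilityMeasure P] {n : ℕ} {R : Ω → Fin n → F}
    (hR : Measurable R)
    (s : Finset (Fin n → F)) :
    ∑ x ∈ s, P.real {ω | R ω = x} = P.real {ω | R ω ∈ s} :=
  sum_measureReal_preimage_singleton s fun x _ => hR (measurableSet_singleton x)

theorem measureReal_fiber_eq_sum_line {F Ω : Type*} [Field F] [Fintype F] [MeasurableSpace F]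
    [MeasurableSingletonClass F] [MeasurableSpace Ω] (P : Measure Ω) [IsProbabilityMeasure P]
    {n k : ℕ} {R : Ω → Fin n → F} (hR : Measurable R)
    {b : Fin n → F} (hb : b ≠ 0) {φ : (Fin n → F) →ₗ[F] (Fin k → F)}
    (hφ : LinearMap.ker φ = F ∙ b) (a : Fin n → F) :
    P.real {ω | φ (R ω) = φ a} = ∑ t : F, P.real {ω | R ω = a + t • b} := by
  classical
  have hinj : Function.Injective fun t : F => a + t • b := fun s t hst =>
    smul_left_injective F hb (add_left_cancel hst)
  rw [← Finset.sum_image (f := fun x => P.real {ω | R ω = x}) (hinj.injOn),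
    sum_measureReal_eq P hR]
  congr 1
  ext ω
  simp only [Set.mem_ofPred_eq, Finset.mem_image, Finset.mem_univ, true_and]
  rw [← sub_eq_zero, ← map_sub, ← LinearMap.mem_ker, hφ, Submodule.mem_span_singleton]
  exact exists_congr fun t => by rw [eq_sub_iff_add_eq, add_comm]

theorem mainTheorem4 {F : Type*} [Field F] [Fintype F]
    [MeasurableSpace F] [MeasurableSingletonClass F]
    (n : ℕ) (hn : 1 ≤ n)
    {Ω : Type*} [MeasurableSpace Ω] (P : Measure Ω) [IsProbabilityMeasure P]
    (R : Ω → Fin n → F) (hR : Measurable R) :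
    ∃ φ : (Fin n → F) →ₗ[F] (Fin (n - 1) → F),
      Function.Surjective φ ∧
        minEntropy (Fintype.card F) P (fun ω => φ (R ω)) ≥
          ((n : ℝ) - 1) / (n : ℝ) * minEntropy (Fintype.card F) P R
            - Real.logb (Fintype.card F : ℝ) (2 - (Fintype.card F : ℝ)⁻¹) := by
  choose φ hφ hker using fun b : {b : Fin n → F // b ≠ 0} => exists_surjective_ker_eq_span b.2
  set q := Fintype.card F with hq
  have hq1 : (1 : ℝ) < q := by exact_mod_cast Fintype.one_lt_card (α := F)
  set f : (Fin n → F) → ℝ := fun x => P.real {ω | R ω = x} with hf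
  have hf0 : ∀ x, 0 ≤ f x := fun x => measureReal_nonneg
  have hsum : ∑ x, f x = 1 := by
    rw [hf, sum_measureReal_eq P hR]
    simp
  set p : ℝ := ⨆ x, f x with hp
  have hfp : ∀ x, f x ≤ p := fun x => le_ciSup (Set.finite_range f).bddAbove x
  obtain ⟨x₀, hx₀⟩ : ∃ x, 0 < f x := by
    by_contra! h
    have := Finset.sum_nonpos fun x (_ : x ∈ Finset.univ) => h x
    linarith
  have hp0 : 0 < p := hx₀.trans_le (hfp x₀)
  set S : {b : Fin n → F // b ≠ 0} → ℝ :=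
    fun b => ⨆ w, P.real {ω | φ b (R ω) = w} with hS
  have : Nonempty {b : Fin n → F // b ≠ 0} :=
    ⟨fun _ => 1, fun h => one_ne_zero (congrFun h ⟨0, hn⟩)⟩
  obtain ⟨b₀, hb₀⟩ := Finite.exists_min S
  have hM : 0 < S b₀ :=
    calc 0 < f x₀ := hx₀
      _ ≤ P.real {ω | φ b₀ (R ω) = φ b₀ x₀} :=
        measureReal_mono fun ω (hω : R ω = x₀) => congrArg (φ b₀) hω
      _ ≤ S b₀ := le_ciSup (f := fun w => P.real {ω | φ b₀ (R ω) = w})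
        (Set.finite_range _).bddAbove _
  have hline : ∀ b : Fin n → F, b ≠ 0 → ∃ a, S b₀ ≤ ∑ t : F, f (a + t • b) := by
    intro b hb
    obtain ⟨w, hw⟩ := exists_eq_ciSup_of_finite (f := fun w => P.real {ω | φ ⟨b, hb⟩ (R ω) = w})
    obtain ⟨a, rfl⟩ := hφ ⟨b, hb⟩ w
    refine ⟨a, (hb₀ ⟨b, hb⟩).trans ?_⟩
    rw [hf, ← measureReal_fiber_eq_sum_line P hR hb (hker ⟨b, hb⟩) a]
    exact hw.ge
  have hkakeya := div_pow_le_sum_pow_of_forall_line hn f hf0 hM hline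
  rw [← hq] at hkakeya
  -- Bound `n - 1` of the factors by `p` and sum the last one to `1`.
  have hbound : ∑ x, f x ^ n ≤ p ^ (n - 1) :=
    calc ∑ x, f x ^ n ≤ ∑ x, p ^ (n - 1) * f x := by
          refine Finset.sum_le_sum fun x _ => ?_
          rw [← pow_sub_one_mul (by omega : n ≠ 0)]
          exact mul_le_mul_of_nonneg_right (pow_le_pow_left₀ (hf0 x) (hfp x) _) (hf0 x)
      _ = p ^ (n - 1) := by rw [← Finset.mul_sum, hsum, mul_one]
  have hc : (0 : ℝ) < 2 - (q : ℝ)⁻¹ := by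
    have := inv_lt_one_of_one_lt₀ hq1
    linarith
  have hlogq : 0 < Real.log q := Real.log_pos hq1
  have hlog := Real.log_le_log (by positivity) (hkakeya.trans hbound)
  rw [Real.log_pow, Real.log_pow, Real.log_div hM.ne' hc.ne', Nat.cast_sub hn, Nat.cast_one]
    at hlog
  have hn0 : (0 : ℝ) < n := by exact_mod_cast hn
  refine ⟨φ b₀, hφ b₀, ?_⟩
  change -Real.logb q (S b₀) ≥ ((n : ℝ) - 1) / n * (-Real.logb q p) - Real.logb q (2 - (q : ℝ)⁻¹)
  have hlog' : Real.log (S b₀) - Real.log (2 - (q : ℝ)⁻¹) ≤ ((n : ℝ) - 1) / n * Real.log p := by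
    rw [div_mul_eq_mul_div, le_div_iff₀ hn0]
    linarith
  have hdiv := div_le_div_of_nonneg_right hlog' hlogq.le
  rw [sub_div, mul_div_assoc] at hdiv
  simp only [Real.logb]
  linarith
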